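/- **Theorem 2.6.** Let $\mathbb K$ be a field of characteristic $0$; algebras are associative $\mathbb K$-algebras, not necessarily unital. Let $(A,m,\sigma)$ be a braided algebra: $(A,m)$ is an algebra and $\sigma$ is an invertible linear endomorphism of $A\otimes A$ such that, with $\sigma_1=\sigma\otimes\mathrm{id}_A$ and $\sigma_2=\mathrm{id}_A\otimes\sigma$ on $A^{\otimes 3}$, $$\sigma_1\sigma_2\sigma_1=\sigma_2\sigma_1\sigma_2,\qquad (\mathrm{id}_A\otimes m)\sigma_1\sigma_2=\sigma(m\otimes\mathrm{id}_A),\qquad (m\otimes\mathrm{id}_A)\sigma_2\sigma_1=\sigma(\mathrm{id}_A\otimes m).$$ Let $\lambda\in\mathbb K$ and $T(A)=\bigoplus_{i\ge 0}A^{\otimes i}$. Let $\beta:T(A)\otimes A\to A\otimes T(A)$ be the linear map whose restriction $\beta_{i,1}$ to $A^{\otimes i}\otimes A$ is $\sigma_1\sigma_2\cdots\sigma_i$ (where $\sigma_k$ is $\sigma$ acting on the factors $k,k+1$ of $A^{\otimes(i+1)}$), with $\beta_{0,1}$ the canonical identification $\mathbb K\otimes A\cong A\otimes\mathbb K$. Let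 $\Join_{\sigma,\lambda}:T(A)\otimes T(A)\to T(A)$ be the quantum quasi-shuffle product of $(A,\lambda m,\sigma)$, i.e. the bilinear product, with restriction $\Join_{(i,j)}$ to $A^{\otimes i}\otimes A^{\otimes j}$, which is scalar multiplication when one argument lies in $A^{\otimes 0}=\mathbb K$ and which satisfies, for $a,b\in A$, $x\in A^{\otimes i}$, $y\in A^{\otimes j}$, $i,j\ge0$, $$\begin{aligned}(a\otimes x)\Join_{\sigma,\lambda}(b\otimes y)={}&a\otimes\bigl(x\Join_{\sigma,\lambda}(b\otimes y)\bigr)+(\mathrm{id}_A\otimes\Join_{(i+1,j)})(\beta_{i+1,1}\otimes\mathrm{id}_A^{\otimes j})(a\otimes x\otimes b\otimes y)\\&+(\lambda m\otimes\Join_{(i,j)})(\mathrm{id}_A\otimes\beta_{i,1}\otimes\mathrm{id}_A^{\otimes j})(a\otimes x\otimes b\otimes y).\end{aligned}$$ Let $\mathcal R_{\sigma,\lambda}(A)$ be the vector space $A\otimes T(A)$ with the product $\lozenge_{\sigma,\lambda}=(m\otimes\Join_{\sigma,\lambda})(\mathrm{id}_A\otimes\beta\otimes\mathrm{id}_{T(A)})$.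 Then $\mathcal R_{\sigma,\lambda}(A)$ is an algebra; the subspaces $A\otimes\mathbb K$ and $\bigoplus_{i\ge1}A\otimes A^{\otimes i}$ are subalgebras of it, and it is their direct sum as a vector space; $a\mapsto a\otimes1$ is an isomorphism of algebras from $A$ onto $A\otimes\mathbb K$. Let $P_1$ and $P_2$ be the projections of $\mathcal R_{\sigma,\lambda}(A)$ onto $A\otimes\mathbb K$ and onto $\bigoplus_{i\ge1}A\otimes A^{\otimes i}$, respectively, each along the other summand. Then $P_1$ and $P_2$ are idempotent Rota–Baxter operators of weight $-1$ on $\mathcal R_{\sigma,\lambda}(A)$: for $P=P_1$ and for $P=P_2$, $P$ is linear, $P^2=P$, and for all $u,v\in\mathcal R_{\sigma,\lambda}(A)$ $$P(u)\,\lozenge_{\sigma,\lambda}\,P(v)=P\bigl(u\,\lozenge_{\sigma,\lambda}\,P(v)\bigr)+P\bigl(P(u)\,\lozenge_{\sigma,\lambda}\,v\bigr)-P(u\,\lozenge_{\sigma,\lambda}\,v).$$ -/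

import Mathlib

open scoped TensorProduct DirectSum

namespace BraidedRotaBaxter

noncomputable section

/-! ### Braided algebras -/

section Braiding

variable {K V : Type*} [Field K] [AddCommGroup V] [Module K V]

/-- `σ₁ = σ ⊗ id` on `V ⊗ V ⊗ V`, bracketed as `V ⊗ (V ⊗ V)`. -/
def sigmaOne (σ : V ⊗[K] V →ₗ[K] V ⊗[K] V) : V ⊗[K] (V ⊗[K] V) →ₗ[K] V ⊗[K] (V ⊗[K] V) :=
  (TensorProduct.assoc K V V V).toLinearMap ∘ₗ LinearMap.rTensor V σ ∘ₗ
    (TensorProduct.assoc K V V V).symm.toLinearMap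

/-- `σ₂ = id ⊗ σ` on `V ⊗ V ⊗ V`, bracketed as `V ⊗ (V ⊗ V)`. -/
def sigmaTwo (σ : V ⊗[K] V →ₗ[K] V ⊗[K] V) : V ⊗[K] (V ⊗[K] V) →ₗ[K] V ⊗[K] (V ⊗[K] V) :=
  LinearMap.lTensor V σ

/-- A braiding: an invertible endomorphism of `V ⊗ V` satisfying the quantum Yang-Baxter equation
`σ₁ σ₂ σ₁ = σ₂ σ₁ σ₂`. -/
structure IsBraiding (σ : V ⊗[K] V →ₗ[K] V ⊗[K] V) : Prop where
  bijective : Function.Bijective σ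
  yang_baxter : sigmaOne σ ∘ₗ sigmaTwo σ ∘ₗ sigmaOne σ = sigmaTwo σ ∘ₗ sigmaOne σ ∘ₗ sigmaTwo σ

end Braiding

/-- A braided algebra `(A, m, σ)`, for a (not necessarily unital) associative `K`-algebra `A` with
product `m`: the map `σ` is a braiding, `(id ⊗ m) σ₁ σ₂ = σ (m ⊗ id)` and
`(m ⊗ id) σ₂ σ₁ = σ (id ⊗ m)`. -/
structure IsBraidedAlgebra {K A : Type*} [Field K] [NonUnitalRing A] [Module K A]
    [IsScalarTower K A A] [SMulCommClass K A A] (σ : A ⊗[K] A →ₗ[K] A ⊗[K] A) : Prop where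
  isBraiding : IsBraiding σ
  sigma_mul_id : LinearMap.lTensor A (LinearMap.mul' K A) ∘ₗ sigmaOne σ ∘ₗ sigmaTwo σ =
    σ ∘ₗ LinearMap.rTensor A (LinearMap.mul' K A) ∘ₗ (TensorProduct.assoc K A A A).symm.toLinearMap
  sigma_id_mul : LinearMap.rTensor A (LinearMap.mul' K A) ∘ₗ
      (TensorProduct.assoc K A A A).symm.toLinearMap ∘ₗ sigmaTwo σ ∘ₗ sigmaOne σ =
    σ ∘ₗ LinearMap.lTensor A (LinearMap.mul' K A)

/-! ### Rota-Baxter operators -/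

section RotaBaxter

variable {K R : Type*} [Field K] [AddCommGroup R] [Module K R]

/-- The bilinear product `mul` makes the vector space `R` a (not necessarily unital) associative
algebra. -/
def IsAlgebraProduct (mul : R →ₗ[K] R →ₗ[K] R) : Prop :=
  ∀ x y z : R, mul (mul x y) z = mul x (mul y z)

/-- The subspace `S` is closed under the product `mul`. -/
def IsSubalgebra (mul : R →ₗ[K] R →ₗ[K] R) (S : Submodule K R) : Prop :=
  ∀ x ∈ S, ∀ y ∈ S, mul x y ∈ S

/-- `((R, mul), P)` is a Rota-Baxter algebra of weight `w`, i.e. `P` is a Rota-Baxter operator of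
weight `w` on the associative algebra `(R, mul)`. -/
structure IsRotaBaxterAlgebra (mul : R →ₗ[K] R →ₗ[K] R) (w : K) (P : R →ₗ[K] R) : Prop where
  isAlgebraProduct : IsAlgebraProduct mul
  rotaBaxter : ∀ x y : R,
    mul (P x) (P y) = P (mul x (P y)) + P (mul (P x) y) + w • P (mul x y)

/-- `P` is an idempotent Rota-Baxter operator of weight `w` on the algebra `(R, mul)`. -/
structure IsIdempotentRotaBaxter (mul : R →ₗ[K] R →ₗ[K] R) (w : K) (P : R →ₗ[K] R) : Prop where
  isRotaBaxterAlgebra : IsRotaBaxterAlgebra mul w P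
  idempotent : P ∘ₗ P = P

end RotaBaxter

/-! ### The tensor space `T(V)` -/

section TensorSpace

variable (K V : Type*) [Field K] [AddCommGroup V] [Module K V]

/-- The underlying vector space of the tensor algebra: `T(V) = ⨁ n, V^{⊗ n}`. -/
abbrev TensorSpace : Type _ := ⨁ n : ℕ, ⨂[K]^n V

/-- The inclusion `V^{⊗ n} → T(V)`. -/
abbrev homogeneous (n : ℕ) : ⨂[K]^n V →ₗ[K] TensorSpace K V :=
  DirectSum.lof K ℕ (fun n => ⨂[K]^n V) n

/-- The identification `V^{⊗ 0} ≃ K`. -/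
def zeroEquiv : ⨂[K]^0 V ≃ₗ[K] K :=
  PiTensorProduct.isEmptyEquiv (Fin 0)

/-- The identification `V ⊗ V^{⊗ n} ≃ V^{⊗ (n + 1)}`,
`v ⊗ (v₁ ⊗ ⋯ ⊗ vₙ) ↦ v ⊗ v₁ ⊗ ⋯ ⊗ vₙ`. -/
def consEquiv (n : ℕ) : V ⊗[K] (⨂[K]^n V) ≃ₗ[K] ⨂[K]^(n + 1) V :=
  (TensorProduct.congr
      (PiTensorProduct.subsingletonEquiv (R := K) (s := fun _ : Fin 1 => V) (0 : Fin 1)).symm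
      (LinearEquiv.refl K (⨂[K]^n V))).trans
    (TensorPower.mulEquiv.trans (TensorPower.cast K V (Nat.add_comm 1 n)))

theorem consEquiv_tmul_tprod (n : ℕ) (v : V) (x : Fin n → V) :
    consEquiv K V n (v ⊗ₜ[K] PiTensorProduct.tprod K x) =
      PiTensorProduct.tprod K (Fin.cons v x : Fin (n + 1) → V) := by
  have h := TensorPower.tprod_mul_tprod K (fun _ : Fin 1 => v) x
  rw [TensorPower.gMul_def] at h
  simp only [consEquiv, LinearEquiv.trans_apply, TensorProduct.congr_tmul,
    PiTensorProduct.subsingletonEquiv_symm_apply', LinearEquiv.refl_apply, h,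
    TensorPower.cast_tprod]
  congr 1
  rw [Fin.append_left_eq_cons]
  ext i
  simp

/-- Left concatenation `V ⊗ T(V) → T(V)`, `v ⊗ x ↦ v ⊗ x`. -/
def consMap : V ⊗[K] TensorSpace K V →ₗ[K] TensorSpace K V :=
  TensorProduct.lift (LinearMap.flip (DirectSum.toModule K ℕ (V →ₗ[K] TensorSpace K V) fun n =>
    LinearMap.flip (TensorProduct.curry
      (homogeneous K V (n + 1) ∘ₗ (consEquiv K V n).toLinearMap))))

end TensorSpace

/-! ### The braiding and the quantum quasi-shuffle product -/

section Reassociate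

variable {K X Y B B' X' : Type*} [Field K] [AddCommGroup X] [Module K X] [AddCommGroup Y]
  [Module K Y] [AddCommGroup B] [Module K B] [AddCommGroup B'] [Module K B']
  [AddCommGroup X'] [Module K X']

/-- `f ⊗ id_Y`, for `f : X ⊗ B → B' ⊗ X'`, as a map `X ⊗ (B ⊗ Y) → B' ⊗ (X' ⊗ Y)`. -/
def actLeft (Y : Type*) [AddCommGroup Y] [Module K Y] (f : X ⊗[K] B →ₗ[K] B' ⊗[K] X') :
    X ⊗[K] (B ⊗[K] Y) →ₗ[K] B' ⊗[K] (X' ⊗[K] Y) :=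
  (TensorProduct.assoc K B' X' Y).toLinearMap ∘ₗ LinearMap.rTensor Y f ∘ₗ
    (TensorProduct.assoc K X B Y).symm.toLinearMap

/-- `id_Z ⊗ f ⊗ id_Y`, for `f : X ⊗ B → B' ⊗ X'`, as a map
`(Z ⊗ X) ⊗ (B ⊗ Y) → (Z ⊗ B') ⊗ (X' ⊗ Y)`. -/
def actMiddle (Z Y : Type*) [AddCommGroup Z] [Module K Z] [AddCommGroup Y] [Module K Y]
    (f : X ⊗[K] B →ₗ[K] B' ⊗[K] X') :
    (Z ⊗[K] X) ⊗[K] (B ⊗[K] Y) →ₗ[K] (Z ⊗[K] B') ⊗[K] (X' ⊗[K] Y) :=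
  (TensorProduct.assoc K Z B' (X' ⊗[K] Y)).symm.toLinearMap ∘ₗ
    LinearMap.lTensor Z (actLeft Y f) ∘ₗ (TensorProduct.assoc K Z X (B ⊗[K] Y)).toLinearMap

end Reassociate

section QuasiShuffle

variable {K V : Type*} [Field K] [AddCommGroup V] [Module K V]

/-- The component `β_{i,1} : V^{⊗ i} ⊗ V → V ⊗ V^{⊗ i}` of the braiding of `T(V)`. It is the lift
`σ₁ σ₂ ⋯ σᵢ` of the permutation `χ_{i,1} = s₁ s₂ ⋯ sᵢ`, which moves the last factor to the front;
`β_{0,1}` is the canonical identification. -/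
def betaOne (σ : V ⊗[K] V →ₗ[K] V ⊗[K] V) :
    (i : ℕ) → (⨂[K]^i V) ⊗[K] V →ₗ[K] V ⊗[K] (⨂[K]^i V)
  | 0 => (TensorProduct.comm K (⨂[K]^0 V) V).toLinearMap
  | i + 1 =>
    LinearMap.lTensor V (consEquiv K V i).toLinearMap ∘ₗ
      actLeft (⨂[K]^i V) σ ∘ₗ
      LinearMap.lTensor V (betaOne σ i) ∘ₗ
      (TensorProduct.assoc K V (⨂[K]^i V) V).toLinearMap ∘ₗ
      LinearMap.rTensor V (consEquiv K V i).symm.toLinearMap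

/-- The restriction `T(V) ⊗ V → V ⊗ T(V)` of the braiding `β` of `T(V)`. -/
def beta (σ : V ⊗[K] V →ₗ[K] V ⊗[K] V) : TensorSpace K V ⊗[K] V →ₗ[K] V ⊗[K] TensorSpace K V :=
  TensorProduct.lift (DirectSum.toModule K ℕ (V →ₗ[K] V ⊗[K] TensorSpace K V) fun i =>
    TensorProduct.curry (LinearMap.lTensor V (homogeneous K V i) ∘ₗ betaOne σ i))

/-- The component `⋈_{i,j} : V^{⊗ i} ⊗ V^{⊗ j} → T(V)` of the quantum quasi-shuffle product built
on `(V, m, σ)`: scalars act by scalar multiplication, and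
`(a ⊗ x) ⋈ (b ⊗ y) = a ⊗ (x ⋈ (b ⊗ y))
  + (id ⊗ ⋈_{i+1,j}) (β_{i+1,1} ⊗ id) (a ⊗ x ⊗ b ⊗ y)
  + (m ⊗ ⋈_{i,j}) (id ⊗ β_{i,1} ⊗ id) (a ⊗ x ⊗ b ⊗ y)`
for `x ∈ V^{⊗ i}`, `y ∈ V^{⊗ j}`. -/
def quasiShuffleComponent (σ : V ⊗[K] V →ₗ[K] V ⊗[K] V) (m : V ⊗[K] V →ₗ[K] V) :
    (i j : ℕ) → (⨂[K]^i V) ⊗[K] (⨂[K]^j V) →ₗ[K] TensorSpace K V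
  | 0, j =>
    homogeneous K V j ∘ₗ (TensorProduct.lid K (⨂[K]^j V)).toLinearMap ∘ₗ
      LinearMap.rTensor (⨂[K]^j V) (zeroEquiv K V).toLinearMap
  | i + 1, 0 =>
    homogeneous K V (i + 1) ∘ₗ (TensorProduct.rid K (⨂[K]^(i + 1) V)).toLinearMap ∘ₗ
      LinearMap.lTensor (⨂[K]^(i + 1) V) (zeroEquiv K V).toLinearMap
  | i + 1, j + 1 =>
    consMap K V ∘ₗ LinearMap.lTensor V (quasiShuffleComponent σ m i (j + 1)) ∘ₗ
        (TensorProduct.assoc K V (⨂[K]^i V) (⨂[K]^(j + 1) V)).toLinearMap ∘ₗ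
        LinearMap.rTensor (⨂[K]^(j + 1) V) (consEquiv K V i).symm.toLinearMap
      + consMap K V ∘ₗ LinearMap.lTensor V (quasiShuffleComponent σ m (i + 1) j) ∘ₗ
        actLeft (⨂[K]^j V) (betaOne σ (i + 1)) ∘ₗ
        LinearMap.lTensor (⨂[K]^(i + 1) V) (consEquiv K V j).symm.toLinearMap
      + consMap K V ∘ₗ TensorProduct.map m (quasiShuffleComponent σ m i j) ∘ₗ
        actMiddle V (⨂[K]^j V) (betaOne σ i) ∘ₗ
        TensorProduct.map (consEquiv K V i).symm.toLinearMap (consEquiv K V j).symm.toLinearMap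

/-- The quantum quasi-shuffle product `⋈ : T(V) ⊗ T(V) → T(V)` built on `(V, m, σ)`. -/
def quasiShuffle (σ : V ⊗[K] V →ₗ[K] V ⊗[K] V) (m : V ⊗[K] V →ₗ[K] V) :
    TensorSpace K V ⊗[K] TensorSpace K V →ₗ[K] TensorSpace K V :=
  TensorProduct.lift (DirectSum.toModule K ℕ (TensorSpace K V →ₗ[K] TensorSpace K V) fun i =>
    LinearMap.flip (DirectSum.toModule K ℕ (⨂[K]^i V →ₗ[K] TensorSpace K V) fun j =>
      LinearMap.flip (TensorProduct.curry (quasiShuffleComponent σ m i j))))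

end QuasiShuffle

/-! ### The algebra `R_{σ,λ}(A)` -/

section Construction

variable (K A : Type*) [Field K] [NonUnitalRing A] [Module K A]

/-- The underlying vector space `A ⊗ T(A)` of `R_{σ,λ}(A)`. -/
abbrev RSpace : Type _ := A ⊗[K] TensorSpace K A

/-- The subspace `A ⊗ K = A ⊗ A^{⊗ 0}` of `A ⊗ T(A)`. -/
def scalarPart : Submodule K (RSpace K A) :=
  LinearMap.range (LinearMap.lTensor A (homogeneous K A 0))

/-- The subspace `⨁_{i ≥ 1} A ⊗ A^{⊗ i}` of `A ⊗ T(A)`. -/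
def positivePart : Submodule K (RSpace K A) :=
  ⨆ (i : ℕ) (_ : 1 ≤ i), LinearMap.range (LinearMap.lTensor A (homogeneous K A i))

/-- The map `A → A ⊗ T(A)`, `a ↦ a ⊗ 1`. -/
def inclusion : A →ₗ[K] RSpace K A :=
  (TensorProduct.mk K A (TensorSpace K A)).flip (homogeneous K A 0 ((zeroEquiv K A).symm 1))

variable {K A} [IsScalarTower K A A] [SMulCommClass K A A]

/-- The product `(m ⊗ ⋈_{σ,λ}) (id_A ⊗ β ⊗ id_{T(A)})` of `R_{σ,λ}(A)`, where `⋈_{σ,λ}` is the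
quantum quasi-shuffle product built on `(A, λ • m, σ)`. -/
def diamond (σ : A ⊗[K] A →ₗ[K] A ⊗[K] A) (lam : K) :
    RSpace K A →ₗ[K] RSpace K A →ₗ[K] RSpace K A :=
  TensorProduct.curry
    (TensorProduct.map (LinearMap.mul' K A) (quasiShuffle σ (lam • LinearMap.mul' K A)) ∘ₗ
      actMiddle A (TensorSpace K A) (beta σ))

end Construction

end

end BraidedRotaBaxter

/-! Maps on T(A) are compared by induction on `consMap`, which puts one letter in front of a tensor.
Write U for `consMap u`, and u ◁ y, x ▷ w, u ◇ v for `rightAct`, `leftAct`, `diamond`. Then (a ⊗ x)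
◇ w = a · (x ▷ w), and the quasi-shuffle recursion becomes U ⋈ V = consMap (u ◁ V + U ▷ v + λ u ◇ v)
(`shuffleMul_consMap`). Expanding (U ⋈ V) ⋈ W and U ⋈ (V ⋈ W) gives seven terms each, so
associativity of ⋈ splits into seven relations of tridendriform type, one of which is (u ◇ v) ◇ w =
u ◇ (v ◇ w).

Each relation follows from associativity of ⋈ on shorter tensors and two compatibilities of the
braiding. Moving a product b * c to the left past a tensor amounts to moving b, then c, and
multiplying (`braid_mul`, from `sigma_id_mul`). Moving a letter past x ⋈ y amounts to moving it past
y, then past x (`braid_shuffleMul`, from Yang–Baxter and `sigma_mul_id`). The relations thus feed an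
induction on all three factors (`shuffleMul_assoc`), and then yield associativity of ◇.

The Rota–Baxter identity is formal: it holds for the projection onto a subalgebra along a
complementary subalgebra. Here the two subalgebras consist of empty and of nonempty tails, and
neither the braiding nor ⋈ turns nonempty tails into empty ones. -/

namespace BraidedRotaBaxter

noncomputable section

/-! ### Induction on T(V) by left concatenation. -/

section TensorSpace

variable {K V : Type*} [Field K] [AddCommGroup V] [Module K V]

variable (K V) in
/-- The unit of `T(V)`. -/
def tensorOne : TensorSpace K V := homogeneous K V 0 ((zeroEquiv K V).symm 1)

theorem consMap_tmul_homogeneous (n : ℕ) (a : V) (x : ⨂[K]^n V) :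
    consMap K V (a ⊗ₜ homogeneous K V n x) =
      homogeneous K V (n + 1) (consEquiv K V n (a ⊗ₜ x)) := by
  simp [consMap]

theorem homogeneous_zero_apply (x : ⨂[K]^0 V) :
    homogeneous K V 0 x = zeroEquiv K V x • tensorOne K V := by
  rw [tensorOne, ← map_smul, ← map_smul, smul_eq_mul, mul_one, LinearEquiv.symm_apply_apply]

theorem homogeneous_mem_of_consMap_mem {p : Submodule K (TensorSpace K V)}
    (one : tensorOne K V ∈ p) (cons : ∀ a, ∀ x ∈ p, consMap K V (a ⊗ₜ x) ∈ p) (n : ℕ)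
    (x : ⨂[K]^n V) : homogeneous K V n x ∈ p := by
  induction n with
  | zero => rw [homogeneous_zero_apply]; exact p.smul_mem _ one
  | succ n ih =>
    obtain ⟨y, rfl⟩ := (consEquiv K V n).surjective x
    induction y with
    | zero => simp
    | add y z hy hz => rw [map_add, map_add]; exact p.add_mem hy hz
    | tmul a y => rw [← consMap_tmul_homogeneous]; exact cons _ _ (ih y)

theorem mem_of_consMap_mem {p : Submodule K (TensorSpace K V)}
    (one : tensorOne K V ∈ p) (cons : ∀ a, ∀ x ∈ p, consMap K V (a ⊗ₜ x) ∈ p)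
    (x : TensorSpace K V) : x ∈ p := by
  induction x using DirectSum.induction_on with
  | zero => exact p.zero_mem
  | of n x => exact homogeneous_mem_of_consMap_mem one cons n x
  | add x y hx hy => exact p.add_mem hx hy

/-- Two linear maps out of `T(V)` agree if they agree at `1` and if their agreement at `x` implies
their agreement at `a ⊗ x`. -/
theorem linearMap_ext_consMap {W : Type*} [AddCommGroup W] [Module K W]
    {f g : TensorSpace K V →ₗ[K] W} (one : f (tensorOne K V) = g (tensorOne K V))
    (cons : ∀ a x, f x = g x → f (consMap K V (a ⊗ₜ x)) = g (consMap K V (a ⊗ₜ x))) : f = g :=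
  LinearMap.ext fun x =>
    mem_of_consMap_mem (p := LinearMap.eqLocus f g) one cons x

@[elab_as_elim]
theorem consMap_induction {p : TensorSpace K V → Prop} (one : p (tensorOne K V))
    (add : ∀ x y, p x → p y → p (x + y)) (smul : ∀ (r : K) x, p x → p (r • x))
    (cons : ∀ a x, p x → p (consMap K V (a ⊗ₜ x))) (x : TensorSpace K V) : p x :=
  mem_of_consMap_mem (p := { carrier := {x | p x}
                             add_mem' := fun {x y} => add x y
                             zero_mem' := by simpa using smul 0 _ one
                             smul_mem' := smul }) one cons x

theorem tensorSpace_induction_homogeneous {p : TensorSpace K V → Prop} (zero : p 0)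
    (add : ∀ x y, p x → p y → p (x + y)) (h : ∀ n x, p (homogeneous K V n x))
    (x : TensorSpace K V) : p x := by
  induction x using DirectSum.induction_on with
  | zero => exact zero
  | of n x => exact h n x
  | add x y hx hy => exact add _ _ hx hy

end TensorSpace

/-! ### Braiding letters past tensors, and Yang–Baxter. -/

section Braiding

variable {K V : Type*} [Field K] [AddCommGroup V] [Module K V] (σ : V ⊗[K] V →ₗ[K] V ⊗[K] V)

/-- Move a vector to the left past a tensor, as a bilinear map. -/
def braid : TensorSpace K V →ₗ[K] V →ₗ[K] V ⊗[K] TensorSpace K V := TensorProduct.curry (beta σ)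

theorem beta_tmul (x : TensorSpace K V) (c : V) : beta σ (x ⊗ₜ c) = braid σ x c := rfl

/-- `a ⊗ (c ⊗ x) ↦ σ(a ⊗ c) ⊗ x`, with the last two factors concatenated. -/
def consBraid : V →ₗ[K] V ⊗[K] TensorSpace K V →ₗ[K] V ⊗[K] TensorSpace K V :=
  TensorProduct.curry (LinearMap.lTensor V (consMap K V) ∘ₗ actLeft (TensorSpace K V) σ)

theorem braid_homogeneous (i : ℕ) (x : ⨂[K]^i V) (c : V) :
    braid σ (homogeneous K V i x) c =
      LinearMap.lTensor V (homogeneous K V i) (betaOne σ i (x ⊗ₜ c)) := by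
  simp [braid, beta]

theorem braid_one (c : V) : braid σ (tensorOne K V) c = c ⊗ₜ tensorOne K V := by
  simp [tensorOne, braid_homogeneous, betaOne]

/-- This is β_{i+1,1} = σ₁ (id ⊗ β_{i,1}), freed of degrees: c passes x first and then a. -/
theorem braid_consMap (a : V) (x : TensorSpace K V) (c : V) :
    braid σ (consMap K V (a ⊗ₜ x)) c = consBraid σ a (braid σ x c) := by
  induction x using tensorSpace_induction_homogeneous with
  | zero => simp
  | add x y hx hy => simp only [TensorProduct.tmul_add, map_add, LinearMap.add_apply, hx, hy]
  | h n x =>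
    rw [consMap_tmul_homogeneous, braid_homogeneous, braid_homogeneous]
    simp only [betaOne, consBraid, LinearMap.comp_apply, LinearEquiv.coe_coe,
      LinearMap.rTensor_tmul, LinearEquiv.symm_apply_apply, TensorProduct.assoc_tmul,
      LinearMap.lTensor_tmul, TensorProduct.curry_apply]
    induction betaOne σ n (x ⊗ₜ c) with
    | zero => simp
    | add p q hp hq => simp only [TensorProduct.tmul_add, map_add, hp, hq]
    | tmul c x =>
      simp only [actLeft, LinearMap.comp_apply, LinearEquiv.coe_coe, LinearMap.rTensor_tmul,
        TensorProduct.assoc_symm_tmul, LinearMap.lTensor_tmul]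
      induction σ (a ⊗ₜ c) with
      | zero => simp
      | add p q hp hq => simp only [TensorProduct.add_tmul, map_add, hp, hq]
      | tmul c a => simp [consMap_tmul_homogeneous]

/-- `σ` acting on the first two factors of `V ⊗ (V ⊗ X)`. -/
def braidFirst (X : Type*) [AddCommGroup X] [Module K X] :
    V ⊗[K] (V ⊗[K] X) →ₗ[K] V ⊗[K] (V ⊗[K] X) := actLeft X σ

theorem braidFirst_tmul {X : Type*} [AddCommGroup X] [Module K X] (a c : V) (x : X) :
    braidFirst σ X (a ⊗ₜ (c ⊗ₜ x)) = TensorProduct.assoc K V V X (σ (a ⊗ₜ c) ⊗ₜ x) := by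
  simp [braidFirst, actLeft]

theorem consBraid_eq (a : V) (p : V ⊗[K] TensorSpace K V) :
    consBraid σ a p = LinearMap.lTensor V (consMap K V) (braidFirst σ (TensorSpace K V) (a ⊗ₜ p)) :=
  rfl

theorem braidFirst_lTensor {X Y : Type*} [AddCommGroup X] [Module K X] [AddCommGroup Y]
    [Module K Y] (f : X →ₗ[K] Y) (p : V ⊗[K] (V ⊗[K] X)) :
    braidFirst σ Y (LinearMap.lTensor V (LinearMap.lTensor V f) p) =
      LinearMap.lTensor V (LinearMap.lTensor V f) (braidFirst σ X p) := by
  suffices h : braidFirst σ Y ∘ₗ LinearMap.lTensor V (LinearMap.lTensor V f) =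
      LinearMap.lTensor V (LinearMap.lTensor V f) ∘ₗ braidFirst σ X from LinearMap.congr_fun h p
  ext a b x
  simp only [TensorProduct.AlgebraTensorModule.curry_apply, LinearMap.restrictScalars_self,
    TensorProduct.curry_apply, LinearMap.comp_apply, LinearMap.lTensor_tmul, braidFirst_tmul]
  induction σ (a ⊗ₜ b) with
  | zero => simp
  | add p q hp hq => simp only [TensorProduct.add_tmul, map_add, hp, hq]
  | tmul a b => simp

/-- Move two vectors to the left past a tensor. -/
def braidTwo (x : TensorSpace K V) : V ⊗[K] V →ₗ[K] V ⊗[K] (V ⊗[K] TensorSpace K V) :=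
  (LinearMap.lTensor V (beta σ) ∘ₗ (TensorProduct.assoc K V (TensorSpace K V) V).toLinearMap) ∘ₗ
    LinearMap.rTensor V (braid σ x)

theorem braidTwo_tmul (x : TensorSpace K V) (b c : V) :
    braidTwo σ x (b ⊗ₜ c) = LinearMap.lTensor V ((braid σ).flip c) (braid σ x b) := by
  simp only [braidTwo, LinearMap.comp_apply, LinearEquiv.coe_coe, LinearMap.rTensor_tmul]
  induction braid σ x b with
  | zero => simp
  | add p q hp hq => simp only [TensorProduct.add_tmul, map_add, hp, hq]
  | tmul b x => simp [beta_tmul]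

/-- `a ⊗ b ⊗ c ⊗ x ↦ σ₂ σ₁ (a ⊗ b ⊗ c) ⊗ x`, with the last two factors concatenated. -/
def consBraidTwo : V →ₗ[K] V ⊗[K] (V ⊗[K] TensorSpace K V) →ₗ[K]
    V ⊗[K] (V ⊗[K] TensorSpace K V) :=
  TensorProduct.curry (LinearMap.lTensor V (LinearMap.lTensor V (consMap K V) ∘ₗ
    actLeft (TensorSpace K V) σ) ∘ₗ actLeft (V ⊗[K] TensorSpace K V) σ)

/-- The word σ₂ σ₁ on three letters is isolated here, so that the axioms of a braided algebra can be
applied to it directly. -/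
theorem consBraidTwo_eq_sigma (a : V) (b c : V) (x : TensorSpace K V) :
    consBraidTwo σ a (b ⊗ₜ (c ⊗ₜ x)) =
      LinearMap.lTensor V (LinearMap.lTensor V (consMap K V ∘ₗ
        (TensorProduct.mk K V (TensorSpace K V)).flip x))
        (sigmaTwo σ (sigmaOne σ (a ⊗ₜ (b ⊗ₜ c)))) := by
  simp only [consBraidTwo, TensorProduct.curry_apply, LinearMap.comp_apply, actLeft, sigmaOne,
    LinearEquiv.coe_coe, TensorProduct.assoc_symm_tmul, LinearMap.rTensor_tmul]
  induction σ (a ⊗ₜ b) with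
  | zero => simp
  | add p q hp hq => simp only [TensorProduct.add_tmul, map_add, hp, hq]
  | tmul b a =>
    simp only [TensorProduct.assoc_tmul, LinearMap.lTensor_tmul, LinearMap.comp_apply,
      LinearEquiv.coe_coe, TensorProduct.assoc_symm_tmul, LinearMap.rTensor_tmul, sigmaTwo]
    induction σ (a ⊗ₜ c) with
    | zero => simp
    | add p q hp hq => simp only [TensorProduct.add_tmul, TensorProduct.tmul_add, map_add, hp, hq]
    | tmul c a => simp

theorem braidTwo_consMap (a : V) (x : TensorSpace K V) (p : V ⊗[K] V) :
    braidTwo σ (consMap K V (a ⊗ₜ x)) p = consBraidTwo σ a (braidTwo σ x p) := by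
  induction p with
  | zero => simp
  | add p q hp hq => simp only [map_add, hp, hq]
  | tmul b c =>
    simp only [braidTwo_tmul, braid_consMap]
    induction braid σ x b with
    | zero => simp
    | add p q hp hq => simp only [map_add, hp, hq]
    | tmul b x =>
      simp only [consBraid, consBraidTwo, TensorProduct.curry_apply, LinearMap.comp_apply, actLeft,
        LinearEquiv.coe_coe, TensorProduct.assoc_symm_tmul, LinearMap.rTensor_tmul,
        LinearMap.lTensor_tmul, LinearMap.flip_apply]
      induction σ (a ⊗ₜ b) with
      | zero => simp
      | add p q hp hq => simp only [TensorProduct.add_tmul, map_add, hp, hq]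
      | tmul b a =>
        simp [braid_consMap, consBraid, actLeft]

variable {σ}

/-- Yang–Baxter on the letters a, b, c: σ₁ (σ₂ σ₁) = (σ₂ σ₁) σ₂, where the last σ₂ braids b with c
before a is passed. -/
theorem braidFirst_consBraidTwo (hσ : IsBraiding σ) (a : V)
    (r : V ⊗[K] (V ⊗[K] TensorSpace K V)) :
    braidFirst σ (TensorSpace K V) (consBraidTwo σ a r) =
      consBraidTwo σ a (braidFirst σ (TensorSpace K V) r) := by
  have key (x : TensorSpace K V) (p : V ⊗[K] V) :
      consBraidTwo σ a (TensorProduct.assoc K V V _ (p ⊗ₜ x)) =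
      LinearMap.lTensor V (LinearMap.lTensor V (consMap K V ∘ₗ
        (TensorProduct.mk K V (TensorSpace K V)).flip x))
        (sigmaTwo σ (sigmaOne σ (a ⊗ₜ p))) := by
    induction p with
    | zero => simp
    | add p q hp hq => simp only [TensorProduct.add_tmul, TensorProduct.tmul_add, map_add, hp, hq]
    | tmul b c => exact consBraidTwo_eq_sigma σ a b c x
  have first (x : TensorSpace K V) (q : V ⊗[K] (V ⊗[K] V)) :
      braidFirst σ (TensorSpace K V) (LinearMap.lTensor V (LinearMap.lTensor V (consMap K V ∘ₗ
        (TensorProduct.mk K V (TensorSpace K V)).flip x)) q) =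
      LinearMap.lTensor V (LinearMap.lTensor V (consMap K V ∘ₗ
        (TensorProduct.mk K V (TensorSpace K V)).flip x)) (sigmaOne σ q) :=
    braidFirst_lTensor σ _ q
  induction r with
  | zero => simp
  | add p q hp hq => simp only [map_add, hp, hq]
  | tmul b r =>
    induction r with
    | zero => simp
    | add p q hp hq => simp only [TensorProduct.tmul_add, map_add, hp, hq]
    | tmul c x =>
      have yb := LinearMap.congr_fun hσ.yang_baxter (a ⊗ₜ (b ⊗ₜ c))
      simp only [LinearMap.comp_apply] at yb
      rw [consBraidTwo_eq_sigma, first, yb]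
      simp only [braidFirst, actLeft, LinearMap.comp_apply, LinearEquiv.coe_coe,
        TensorProduct.assoc_symm_tmul, LinearMap.rTensor_tmul, key]
      simp [sigmaTwo]

/-- Two letters may be braided before or after they cross x. Each letter of x costs one use of
Yang–Baxter. -/
theorem braidFirst_braidTwo (hσ : IsBraiding σ) (x : TensorSpace K V) (p : V ⊗[K] V) :
    braidFirst σ (TensorSpace K V) (braidTwo σ x p) = braidTwo σ x (σ p) := by
  -- `braidTwo` is bundled as linear only in the pair of letters; the induction on x needs linearity
  -- in x too.
  have hlin : ∃ W : TensorSpace K V →ₗ[K] V ⊗[K] V →ₗ[K] V ⊗[K] (V ⊗[K] TensorSpace K V),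
      ∀ x, W x = braidTwo σ x :=
    ⟨LinearMap.llcomp K _ _ _ (LinearMap.lTensor V (beta σ) ∘ₗ
      (TensorProduct.assoc K V (TensorSpace K V) V).toLinearMap) ∘ₗ
        LinearMap.rTensorHom V ∘ₗ braid σ, fun x => rfl⟩
  obtain ⟨W, hW⟩ := hlin
  suffices h : braidFirst σ (TensorSpace K V) ∘ₗ W.flip p = W.flip (σ p) by
    simpa [hW] using LinearMap.congr_fun h x
  refine linearMap_ext_consMap ?_ fun a x hx => ?_
  · simp only [LinearMap.comp_apply, LinearMap.flip_apply, hW]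
    induction p with
    | zero => simp
    | add p q hp hq => simp only [map_add, hp, hq]
    | tmul b c =>
      have one (q : V ⊗[K] V) : braidTwo σ (tensorOne K V) q =
          TensorProduct.assoc K V V _ (q ⊗ₜ tensorOne K V) := by
        induction q with
        | zero => simp
        | add p q hp hq => simp only [TensorProduct.add_tmul, map_add, hp, hq]
        | tmul b c => simp [braidTwo_tmul, braid_one]
      simp [one, braidFirst, actLeft]
  · simp only [LinearMap.comp_apply, LinearMap.flip_apply, hW] at hx ⊢
    rw [braidTwo_consMap, braidTwo_consMap, braidFirst_consBraidTwo hσ, hx]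

end Braiding

/-! ### The products as actions of T(A) on A ⊗ T(A). -/

section Product

variable {K A : Type*} [Field K] [NonUnitalRing A] [Module K A]
  [IsScalarTower K A A] [SMulCommClass K A A] {σ : A ⊗[K] A →ₗ[K] A ⊗[K] A}

/-- Multiply the first two factors of `A ⊗ (A ⊗ X)`. -/
def mulFirst (X : Type*) [AddCommGroup X] [Module K X] :
    A ⊗[K] (A ⊗[K] X) →ₗ[K] A ⊗[K] X :=
  LinearMap.rTensor X (LinearMap.mul' K A) ∘ₗ (TensorProduct.assoc K A A X).symm.toLinearMap

theorem mulFirst_tmul {X : Type*} [AddCommGroup X] [Module K X] (a b : A) (x : X) :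
    mulFirst (K := K) X (a ⊗ₜ (b ⊗ₜ x)) = (a * b) ⊗ₜ x := by
  simp [mulFirst]

theorem mulFirst_lTensor {X Y : Type*} [AddCommGroup X] [Module K X] [AddCommGroup Y] [Module K Y]
    (f : X →ₗ[K] Y) (p : A ⊗[K] (A ⊗[K] X)) :
    mulFirst Y (LinearMap.lTensor A (LinearMap.lTensor A f) p) =
      LinearMap.lTensor A f (mulFirst X p) := by
  suffices h : mulFirst Y ∘ₗ LinearMap.lTensor A (LinearMap.lTensor A f) =
      LinearMap.lTensor A f ∘ₗ mulFirst X from LinearMap.congr_fun h p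
  ext a b x
  simp [mulFirst_tmul]

theorem mulFirst_consBraidTwo (hσ : IsBraidedAlgebra σ) (a : A)
    (r : A ⊗[K] (A ⊗[K] TensorSpace K A)) :
    mulFirst (TensorSpace K A) (consBraidTwo σ a r) =
      consBraid σ a (mulFirst (TensorSpace K A) r) := by
  induction r with
  | zero => simp
  | add p q hp hq => simp only [map_add, hp, hq]
  | tmul b r =>
    induction r with
    | zero => simp
    | add p q hp hq => simp only [TensorProduct.tmul_add, map_add, hp, hq]
    | tmul c x =>
      have h := LinearMap.congr_fun hσ.sigma_id_mul (a ⊗ₜ (b ⊗ₜ c))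
      simp only [LinearMap.comp_apply, LinearMap.lTensor_tmul, LinearMap.mul'_apply] at h
      rw [consBraidTwo_eq_sigma, mulFirst_lTensor, mulFirst_tmul, mulFirst, LinearMap.comp_apply, h]
      simp only [consBraid, TensorProduct.curry_apply, LinearMap.comp_apply, actLeft,
        LinearEquiv.coe_coe, TensorProduct.assoc_symm_tmul, LinearMap.rTensor_tmul]
      induction σ (a ⊗ₜ (b * c)) with
      | zero => simp
      | add p q hp hq => simp only [TensorProduct.add_tmul, map_add, hp, hq]
      | tmul b a => simp

/-- Induction on x: (m ⊗ id) σ₂ σ₁ = σ (id ⊗ m) carries the product past one more letter. -/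
theorem braid_mul (hσ : IsBraidedAlgebra σ) (x : TensorSpace K A) (b c : A) :
    braid σ x (b * c) = mulFirst (TensorSpace K A) (braidTwo σ x (b ⊗ₜ c)) := by
  suffices h : (braid σ).flip (b * c) =
      (mulFirst (TensorSpace K A) ∘ₗ LinearMap.lTensor A ((braid σ).flip c)) ∘ₗ
        (braid σ).flip b by
    simpa [braidTwo_tmul] using LinearMap.congr_fun h x
  refine linearMap_ext_consMap ?_ fun a x hx => ?_
  · simp [braid_one, mulFirst_tmul]
  · simp only [LinearMap.comp_apply, LinearMap.flip_apply, ← braidTwo_tmul] at hx ⊢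
    rw [braid_consMap, braidTwo_consMap, hx, mulFirst_consBraidTwo hσ]

variable (σ) (lam : K)

/-- The quantum quasi-shuffle product of `(A, lam • m, σ)`, as a bilinear map. -/
def shuffleMul : TensorSpace K A →ₗ[K] TensorSpace K A →ₗ[K] TensorSpace K A :=
  TensorProduct.curry (quasiShuffle σ (lam • LinearMap.mul' K A))

/-- The right action of `T(A)` on `A ⊗ T(A)` by multiplication of the second factor. -/
def rightAct : TensorSpace K A →ₗ[K] RSpace K A →ₗ[K] RSpace K A :=
  LinearMap.lTensorHom A ∘ₗ (shuffleMul σ lam).flip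

/-- The left action of `T(A)` on `A ⊗ T(A)` through the braiding. -/
def leftAct : TensorSpace K A →ₗ[K] RSpace K A →ₗ[K] RSpace K A :=
  TensorProduct.curry (LinearMap.lTensor A (quasiShuffle σ (lam • LinearMap.mul' K A)) ∘ₗ
    actLeft (TensorSpace K A) (beta σ))

/-- Multiplication from the left of the first factor of `A ⊗ T(A)`. -/
def mulHead : A →ₗ[K] RSpace K A →ₗ[K] RSpace K A :=
  LinearMap.rTensorHom (TensorSpace K A) ∘ₗ LinearMap.mul K A

theorem mulHead_tmul (a b : A) (x : TensorSpace K A) :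
    mulHead (K := K) a (b ⊗ₜ x) = (a * b) ⊗ₜ x := by
  simp [mulHead]

theorem rightAct_tmul (y : TensorSpace K A) (a : A) (x : TensorSpace K A) :
    rightAct σ lam y (a ⊗ₜ x) = a ⊗ₜ shuffleMul σ lam x y := by
  simp [rightAct]

theorem leftAct_tmul (x : TensorSpace K A) (c : A) (z : TensorSpace K A) :
    leftAct σ lam x (c ⊗ₜ z) = rightAct σ lam z (braid σ x c) := by
  simp only [leftAct, TensorProduct.curry_apply, LinearMap.comp_apply, actLeft,
    LinearEquiv.coe_coe, TensorProduct.assoc_symm_tmul, LinearMap.rTensor_tmul, beta_tmul]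
  induction braid σ x c with
  | zero => simp
  | add p q hp hq => simp only [TensorProduct.add_tmul, map_add, hp, hq]
  | tmul c x => simp [rightAct_tmul, shuffleMul]

theorem diamond_tmul (a : A) (x : TensorSpace K A) (w : RSpace K A) :
    diamond σ lam (a ⊗ₜ x) w = mulHead a (leftAct σ lam x w) := by
  induction w using TensorProduct.induction_on with
  | zero => simp
  | add p q hp hq => simp only [map_add, hp, hq]
  | tmul b y =>
    simp only [diamond, TensorProduct.curry_apply, LinearMap.comp_apply, actMiddle, actLeft,
      LinearEquiv.coe_coe, TensorProduct.assoc_tmul, LinearMap.lTensor_tmul,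
      TensorProduct.assoc_symm_tmul, LinearMap.rTensor_tmul, beta_tmul, leftAct_tmul]
    induction braid σ x b with
    | zero => simp
    | add p q hp hq => simp only [TensorProduct.add_tmul, TensorProduct.tmul_add, map_add, hp, hq]
    | tmul c x => simp [rightAct_tmul, mulHead_tmul, shuffleMul]

theorem shuffleMul_homogeneous (i j : ℕ) (x : ⨂[K]^i A) (y : ⨂[K]^j A) :
    shuffleMul σ lam (homogeneous K A i x) (homogeneous K A j y) =
      quasiShuffleComponent σ (lam • LinearMap.mul' K A) i j (x ⊗ₜ y) := by
  simp [shuffleMul, quasiShuffle]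

theorem shuffleMul_one_left (y : TensorSpace K A) :
    shuffleMul σ lam (tensorOne K A) y = y := by
  induction y using tensorSpace_induction_homogeneous with
  | zero => simp
  | add x y hx hy => rw [map_add, hx, hy]
  | h n y => rw [tensorOne, shuffleMul_homogeneous]; simp [quasiShuffleComponent]

theorem shuffleMul_one_right (x : TensorSpace K A) :
    shuffleMul σ lam x (tensorOne K A) = x := by
  induction x using tensorSpace_induction_homogeneous with
  | zero => simp
  | add x y hx hy => rw [map_add, LinearMap.add_apply, hx, hy]
  | h n x =>
    rw [tensorOne, shuffleMul_homogeneous]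
    cases n with
    | zero =>
      -- In degree (0, 0) the product is given by the clause for a scalar on the left, so x itself
      -- must be rewritten as a multiple of the unit.
      simp only [quasiShuffleComponent, LinearMap.comp_apply, LinearMap.rTensor_tmul,
        LinearEquiv.coe_coe, TensorProduct.lid_tmul]
      rw [homogeneous_zero_apply x, map_smul, tensorOne]
    | succ n => simp [quasiShuffleComponent]

theorem shuffleMul_consMap_tmul (a b : A) (x y : TensorSpace K A) :
    shuffleMul σ lam (consMap K A (a ⊗ₜ x)) (consMap K A (b ⊗ₜ y)) =
      consMap K A (rightAct σ lam (consMap K A (b ⊗ₜ y)) (a ⊗ₜ x)) +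
      consMap K A (leftAct σ lam (consMap K A (a ⊗ₜ x)) (b ⊗ₜ y)) +
      lam • consMap K A (diamond σ lam (a ⊗ₜ x) (b ⊗ₜ y)) := by
  induction x using tensorSpace_induction_homogeneous with
  | zero => simp
  | add x x' hx hx' =>
    simp only [TensorProduct.tmul_add, map_add, LinearMap.add_apply, hx, hx', smul_add]; abel
  | h i x =>
    induction y using tensorSpace_induction_homogeneous with
    | zero => simp
    | add y y' hy hy' =>
      simp only [TensorProduct.tmul_add, map_add, LinearMap.add_apply, hy, hy', smul_add]; abel
    | h j y =>
      simp only [consMap_tmul_homogeneous, shuffleMul_homogeneous, quasiShuffleComponent,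
        LinearMap.add_apply, diamond_tmul, leftAct_tmul, rightAct_tmul, braid_homogeneous]
      congr 1
      · congr 1
        · simp
        · simp only [LinearMap.comp_apply, LinearMap.lTensor_tmul, LinearEquiv.coe_coe,
            LinearEquiv.symm_apply_apply, actLeft, TensorProduct.assoc_symm_tmul,
            LinearMap.rTensor_tmul]
          induction betaOne σ (i + 1) (consEquiv K A i (a ⊗ₜ x) ⊗ₜ b) with
          | zero => simp
          | add p q hp hq => simp only [TensorProduct.add_tmul, map_add, hp, hq]
          | tmul b z => simp [rightAct_tmul, shuffleMul_homogeneous]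
      · simp only [LinearMap.comp_apply, TensorProduct.map_tmul, LinearMap.lTensor_tmul,
          LinearEquiv.coe_coe, LinearEquiv.symm_apply_apply, actMiddle, actLeft,
          TensorProduct.assoc_symm_tmul, TensorProduct.assoc_tmul, LinearMap.rTensor_tmul]
        induction betaOne σ i (x ⊗ₜ b) with
        | zero => simp
        | add p q hp hq =>
          simp only [TensorProduct.add_tmul, TensorProduct.tmul_add, map_add, hp, hq, smul_add]
        | tmul b z =>
          simp [rightAct_tmul, mulHead_tmul, shuffleMul_homogeneous, ← TensorProduct.smul_tmul']

/-- The recursion for arbitrary u and v, not only pure tensors, so that it can be iterated: the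
argument of `consMap` on the right is again such an element. -/
theorem shuffleMul_consMap (u v : RSpace K A) :
    shuffleMul σ lam (consMap K A u) (consMap K A v) =
      consMap K A (rightAct σ lam (consMap K A v) u + leftAct σ lam (consMap K A u) v +
        lam • diamond σ lam u v) := by
  induction u using TensorProduct.induction_on with
  | zero => simp
  | add u u' hu hu' =>
    simp only [map_add, LinearMap.add_apply, hu, hu', smul_add]; abel
  | tmul a x =>
    induction v using TensorProduct.induction_on with
    | zero => simp
    | add v v' hv hv' =>
      simp only [map_add, LinearMap.add_apply, hv, hv', smul_add]; abel
    | tmul b y => simp only [shuffleMul_consMap_tmul, map_add, map_smul]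

end Product

/-! ### Associativity of the quasi-shuffle product and of `diamond`. -/

section Associativity

variable {K A : Type*} [Field K] [NonUnitalRing A] [Module K A]
  [IsScalarTower K A A] [SMulCommClass K A A] {σ : A ⊗[K] A →ₗ[K] A ⊗[K] A}

theorem braidFirst_mul_tmul (hσ : IsBraidedAlgebra σ) {X : Type*} [AddCommGroup X] [Module K X]
    (a b : A) (r : A ⊗[K] X) :
    braidFirst σ X ((a * b) ⊗ₜ r) =
      LinearMap.lTensor A (mulFirst X)
        (braidFirst σ (A ⊗[K] X) (a ⊗ₜ braidFirst σ X (b ⊗ₜ r))) := by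
  induction r with
  | zero => simp
  | add p q hp hq => simp only [TensorProduct.tmul_add, map_add, hp, hq]
  | tmul c x =>
    have h := LinearMap.congr_fun hσ.sigma_mul_id (a ⊗ₜ (b ⊗ₜ c))
    simp only [LinearMap.comp_apply, LinearEquiv.coe_coe, TensorProduct.assoc_symm_tmul,
      LinearMap.rTensor_tmul, LinearMap.mul'_apply, sigmaTwo, LinearMap.lTensor_tmul,
      sigmaOne] at h
    rw [braidFirst_tmul, braidFirst_tmul, ← h]
    induction σ (b ⊗ₜ c) with
    | zero => simp
    | add p q hp hq => simp only [TensorProduct.add_tmul, TensorProduct.tmul_add, map_add, hp, hq]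
    | tmul c b =>
      simp only [TensorProduct.assoc_symm_tmul, TensorProduct.assoc_tmul, LinearMap.rTensor_tmul,
        braidFirst_tmul]
      induction σ (a ⊗ₜ c) with
      | zero => simp
      | add p q hp hq => simp only [TensorProduct.add_tmul, map_add, hp, hq]
      | tmul c a => simp [mulFirst_tmul]

theorem mulFirst_tmul_eq (a : A) (p : RSpace K A) :
    mulFirst (TensorSpace K A) (a ⊗ₜ p) = mulHead a p := by
  induction p using TensorProduct.induction_on with
  | zero => simp
  | add p q hp hq => simp only [TensorProduct.tmul_add, map_add, hp, hq]
  | tmul b x => simp [mulFirst_tmul, mulHead_tmul]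

theorem mulHead_mulHead (a b : A) (p : RSpace K A) :
    mulHead a (mulHead b p) = mulHead (a * b) p := by
  induction p using TensorProduct.induction_on with
  | zero => simp
  | add p q hp hq => simp only [map_add, hp, hq]
  | tmul c x => simp [mulHead_tmul, mul_assoc]

variable (lam : K)

theorem mulHead_rightAct (a : A) (y : TensorSpace K A) (p : RSpace K A) :
    mulHead a (rightAct σ lam y p) = rightAct σ lam y (mulHead a p) := by
  induction p using TensorProduct.induction_on with
  | zero => simp
  | add p q hp hq => simp only [map_add, hp, hq]
  | tmul c x => simp [mulHead_tmul, rightAct_tmul]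

theorem diamond_mulHead (a : A) (u v : RSpace K A) :
    diamond σ lam (mulHead a u) v = mulHead a (diamond σ lam u v) := by
  induction u using TensorProduct.induction_on with
  | zero => simp
  | add p q hp hq => simp only [map_add, LinearMap.add_apply, hp, hq]
  | tmul c x => simp [mulHead_tmul, diamond_tmul, mulHead_mulHead]

theorem rightAct_one (p : RSpace K A) : rightAct σ lam (tensorOne K A) p = p := by
  induction p using TensorProduct.induction_on with
  | zero => simp
  | add p q hp hq => simp only [map_add, hp, hq]
  | tmul c x => simp [rightAct_tmul, shuffleMul_one_right]

theorem leftAct_one (p : RSpace K A) : leftAct σ lam (tensorOne K A) p = p := by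
  induction p using TensorProduct.induction_on with
  | zero => simp
  | add p q hp hq => simp only [map_add, hp, hq]
  | tmul c x => simp [leftAct_tmul, braid_one, rightAct_tmul, shuffleMul_one_left]

variable (σ) in
/-- `(b ⊗ x, q) ↦ consBraid σ b (x ▷ q)`. -/
def consLeftAct : RSpace K A →ₗ[K] RSpace K A →ₗ[K] RSpace K A :=
  TensorProduct.curry (TensorProduct.lift (consBraid σ) ∘ₗ
    LinearMap.lTensor A (TensorProduct.lift (leftAct σ lam)) ∘ₗ
      (TensorProduct.assoc K A (TensorSpace K A) (RSpace K A)).toLinearMap)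

theorem consLeftAct_tmul (b : A) (x : TensorSpace K A) (q : RSpace K A) :
    consLeftAct σ lam (b ⊗ₜ x) q = consBraid σ b (leftAct σ lam x q) := by
  simp [consLeftAct]

theorem consBraid_rightAct (b : A) (y : TensorSpace K A) (p : RSpace K A) :
    consBraid σ b (rightAct σ lam y p) =
      LinearMap.lTensor A (consMap K A ∘ₗ rightAct σ lam y)
        (braidFirst σ (TensorSpace K A) (b ⊗ₜ p)) := by
  have h := braidFirst_lTensor σ ((shuffleMul σ lam).flip y) (b ⊗ₜ[K] p)
  rw [LinearMap.lTensor_tmul] at h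
  rw [consBraid_eq, LinearMap.lTensor_comp, LinearMap.comp_apply]
  exact congrArg _ h

/-- For p = `braid σ x b` the inner expression is `braidFirst` of `braidTwo σ x (b ⊗ₜ c)`, the shape
to which `braidFirst_braidTwo` applies. -/
theorem consLeftAct_apply_tmul (p : RSpace K A) (c : A) (y : TensorSpace K A) :
    consLeftAct σ lam p (c ⊗ₜ y) =
      LinearMap.lTensor A (consMap K A ∘ₗ rightAct σ lam y)
        (braidFirst σ (TensorSpace K A) (LinearMap.lTensor A ((braid σ).flip c) p)) := by
  induction p using TensorProduct.induction_on with
  | zero => simp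
  | add p q hp hq => simp only [map_add, LinearMap.add_apply, hp, hq]
  | tmul b x => simp [consLeftAct_tmul, leftAct_tmul, consBraid_rightAct]

/-- Here (id ⊗ m) σ₁ σ₂ = σ (m ⊗ id) splits the crossing of c with the product a * b into two
crossings, again exposing `braidFirst` on the two letters. -/
theorem consLeftAct_mulHead_apply_tmul (hσ : IsBraidedAlgebra σ) (a : A) (p : RSpace K A) (c : A)
    (y : TensorSpace K A) :
    consLeftAct σ lam (mulHead a p) (c ⊗ₜ y) =
      LinearMap.lTensor A (consMap K A ∘ₗ rightAct σ lam y)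
        (LinearMap.lTensor A (mulFirst (TensorSpace K A)) (braidFirst σ (RSpace K A)
          (a ⊗ₜ braidFirst σ (TensorSpace K A) (LinearMap.lTensor A ((braid σ).flip c) p)))) := by
  induction p using TensorProduct.induction_on with
  | zero => simp
  | add p q hp hq => simp only [map_add, LinearMap.add_apply, TensorProduct.tmul_add, hp, hq]
  | tmul b x =>
    simp [consLeftAct_tmul, leftAct_tmul, consBraid_rightAct, mulHead_tmul,
      braidFirst_mul_tmul hσ]

theorem rightAct_consMap_consBraid (a b : A) (y : TensorSpace K A) (r : RSpace K A) :
    rightAct σ lam (consMap K A (b ⊗ₜ y)) (consBraid σ a r) =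
      consBraid σ a (rightAct σ lam (consMap K A (b ⊗ₜ y)) r) +
      LinearMap.lTensor A (consMap K A ∘ₗ rightAct σ lam y)
        (LinearMap.lTensor A ((braid σ).flip b) (consBraid σ a r)) +
      lam • LinearMap.lTensor A (consMap K A ∘ₗ rightAct σ lam y)
        (LinearMap.lTensor A (mulFirst (TensorSpace K A)) (braidFirst σ (RSpace K A)
          (a ⊗ₜ LinearMap.lTensor A ((braid σ).flip b) r))) := by
  induction r using TensorProduct.induction_on with
  | zero => simp
  | add p q hp hq => simp only [map_add, TensorProduct.tmul_add, hp, hq, smul_add]; abel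
  | tmul e x =>
    simp only [consBraid_eq, rightAct_tmul, LinearMap.lTensor_tmul, braidFirst_tmul,
      LinearMap.flip_apply]
    induction σ (a ⊗ₜ e) with
    | zero => simp
    | add p q hp hq => simp only [TensorProduct.add_tmul, map_add, hp, hq, smul_add]; abel
    | tmul f a =>
      simp [rightAct_tmul, shuffleMul_consMap_tmul, leftAct_tmul, diamond_tmul,
        mulFirst_tmul_eq, mulHead_rightAct, TensorProduct.tmul_add]

/-- The three summands mirror the quasi-shuffle recursion for (a ⊗ x) ⋈ (b ⊗ y). Yang–Baxter moves
σ(b ⊗ c) inside `braidTwo`; on each of its terms the claim is `rightAct_consMap_consBraid`. -/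
theorem leftAct_consMap_consBraid (hσ : IsBraidedAlgebra σ) (a b : A) (x : TensorSpace K A)
    (q : RSpace K A) :
    leftAct σ lam (consMap K A (a ⊗ₜ x)) (consBraid σ b q) =
      consBraid σ a (leftAct σ lam x (consBraid σ b q)) +
      consLeftAct σ lam (braid σ (consMap K A (a ⊗ₜ x)) b) q +
      lam • consLeftAct σ lam (mulHead a (braid σ x b)) q := by
  induction q using TensorProduct.induction_on with
  | zero => simp
  | add p q hp hq => simp only [map_add, hp, hq, smul_add]; abel
  | tmul c y =>
    rw [consLeftAct_apply_tmul, consLeftAct_mulHead_apply_tmul lam hσ, ← braidTwo_tmul,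
      ← braidTwo_tmul, braidFirst_braidTwo hσ.isBraiding, braidFirst_braidTwo hσ.isBraiding,
      consBraid_eq σ b, braidFirst_tmul]
    induction σ (b ⊗ₜ c) with
    | zero => simp
    | add p q hp hq =>
      simp only [TensorProduct.add_tmul, TensorProduct.tmul_add, map_add, hp, hq, smul_add]; abel
    | tmul d b =>
      simp only [TensorProduct.assoc_tmul, LinearMap.lTensor_tmul, leftAct_tmul, braidTwo_tmul,
        braid_consMap]
      exact rightAct_consMap_consBraid lam a b y _

/-- Induction on y, then on x. The three terms of the recursion match those of
`leftAct_consMap_consBraid`: the first by the hypothesis for x, the other two by the hypothesis for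
y with an arbitrary left factor. -/
theorem braid_shuffleMul (hσ : IsBraidedAlgebra σ) (x y : TensorSpace K A) (c : A) :
    braid σ (shuffleMul σ lam x y) c = leftAct σ lam x (braid σ y c) := by
  suffices h : (shuffleMul σ lam).flip.compr₂ ((braid σ).flip c) =
      (leftAct σ lam).flip ∘ₗ (braid σ).flip c from
    LinearMap.congr_fun (LinearMap.congr_fun h y) x
  refine linearMap_ext_consMap ?_ fun b y hy => ?_
  · refine LinearMap.ext fun x => ?_
    simp [shuffleMul_one_right, braid_one, leftAct_tmul, rightAct_one]
  · replace hy (x) : braid σ (shuffleMul σ lam x y) c = leftAct σ lam x (braid σ y c) :=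
      LinearMap.congr_fun hy x
    have two (p : RSpace K A) : braid σ (consMap K A (rightAct σ lam y p)) c =
        consLeftAct σ lam p (braid σ y c) := by
      induction p using TensorProduct.induction_on with
      | zero => simp
      | add p q hp hq => simp only [map_add, LinearMap.add_apply, hp, hq]
      | tmul b x => rw [rightAct_tmul, braid_consMap, hy, consLeftAct_tmul]
    refine linearMap_ext_consMap ?_ fun a x hx => ?_
    · simp [shuffleMul_one_left, leftAct_one]
    · replace hx : braid σ (shuffleMul σ lam x (consMap K A (b ⊗ₜ y))) c =
        leftAct σ lam x (braid σ (consMap K A (b ⊗ₜ y)) c) := hx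
      change braid σ (shuffleMul σ lam (consMap K A (a ⊗ₜ x)) (consMap K A (b ⊗ₜ y))) c =
        leftAct σ lam (consMap K A (a ⊗ₜ x)) (braid σ (consMap K A (b ⊗ₜ y)) c)
      rw [braid_consMap σ b, leftAct_consMap_consBraid lam hσ, ← braid_consMap σ b, ← hx,
        ← braid_consMap σ a, ← two, ← two, shuffleMul_consMap_tmul, rightAct_tmul, leftAct_tmul,
        diamond_tmul, leftAct_tmul, mulHead_rightAct]
      simp

/-! ### The relations between the actions, conditional on associativity of ⋈. -/

section Relations

variable {lam}

/-- Associativity is assumed only for the given y and z, as it must be for use inside the induction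
that proves it. -/
theorem rightAct_rightAct {y z : TensorSpace K A}
    (h : ∀ x, shuffleMul σ lam (shuffleMul σ lam x y) z =
      shuffleMul σ lam x (shuffleMul σ lam y z)) (p : RSpace K A) :
    rightAct σ lam z (rightAct σ lam y p) = rightAct σ lam (shuffleMul σ lam y z) p := by
  induction p using TensorProduct.induction_on with
  | zero => simp
  | add p q hp hq => simp only [map_add, hp, hq]
  | tmul a x => simp only [rightAct_tmul, h]

theorem rightAct_leftAct_tmul {y z : TensorSpace K A}
    (h : ∀ x, shuffleMul σ lam (shuffleMul σ lam x y) z =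
      shuffleMul σ lam x (shuffleMul σ lam y z)) (t : TensorSpace K A) (b : A) :
    rightAct σ lam z (leftAct σ lam t (b ⊗ₜ y)) =
      leftAct σ lam t (rightAct σ lam z (b ⊗ₜ y)) := by
  rw [leftAct_tmul, rightAct_rightAct h, rightAct_tmul, leftAct_tmul]

theorem rightAct_diamond_tmul {y z : TensorSpace K A}
    (h : ∀ x, shuffleMul σ lam (shuffleMul σ lam x y) z =
      shuffleMul σ lam x (shuffleMul σ lam y z)) (u : RSpace K A) (b : A) :
    rightAct σ lam z (diamond σ lam u (b ⊗ₜ y)) =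
      diamond σ lam u (rightAct σ lam z (b ⊗ₜ y)) := by
  induction u using TensorProduct.induction_on with
  | zero => simp
  | add p q hp hq => simp only [map_add, LinearMap.add_apply, hp, hq]
  | tmul a x => rw [diamond_tmul, diamond_tmul, ← mulHead_rightAct, rightAct_leftAct_tmul h]

theorem diamond_tmul_one (p : RSpace K A) (c : A) :
    diamond σ lam p (c ⊗ₜ tensorOne K A) =
      mulFirst (TensorSpace K A) (LinearMap.lTensor A ((braid σ).flip c) p) := by
  induction p using TensorProduct.induction_on with
  | zero => simp
  | add p q hp hq => simp only [map_add, LinearMap.add_apply, hp, hq]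
  | tmul a x =>
    simp [diamond_tmul, leftAct_tmul, rightAct_one, mulFirst_tmul_eq]

/-- Once the tail z of p is split off as a right action, this is `braid_mul`. -/
theorem leftAct_mulHead (hσ : IsBraidedAlgebra σ) (t : TensorSpace K A) (b : A) (p : RSpace K A) :
    leftAct σ lam t (mulHead b p) = diamond σ lam (braid σ t b) p := by
  induction p using TensorProduct.induction_on with
  | zero => simp
  | add p q hp hq => simp only [map_add, hp, hq]
  | tmul c z =>
    have hz : c ⊗ₜ[K] z = rightAct σ lam z (c ⊗ₜ[K] tensorOne K A) := by
      rw [rightAct_tmul, shuffleMul_one_left]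
    rw [mulHead_tmul, leftAct_tmul, braid_mul hσ, braidTwo_tmul, ← diamond_tmul_one (lam := lam),
      rightAct_diamond_tmul, ← hz]
    -- The associativity needed to pull out z has the unit as middle factor, so it holds
    -- unconditionally.
    intro x
    rw [shuffleMul_one_left, shuffleMul_one_right]

variable {z : TensorSpace K A} (h : ∀ x y, shuffleMul σ lam (shuffleMul σ lam x y) z =
      shuffleMul σ lam x (shuffleMul σ lam y z))

include h

theorem rightAct_leftAct (t : TensorSpace K A) (p : RSpace K A) :
    rightAct σ lam z (leftAct σ lam t p) = leftAct σ lam t (rightAct σ lam z p) := by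
  induction p using TensorProduct.induction_on with
  | zero => simp
  | add p q hp hq => simp only [map_add, hp, hq]
  | tmul a x => exact rightAct_leftAct_tmul (fun t => h t x) t a

/-- The letter c crosses t ⋈ s by crossing s and then t (`braid_shuffleMul`); the right action of z
commutes with the second crossing. -/
theorem leftAct_leftAct (hσ : IsBraidedAlgebra σ) (t s : TensorSpace K A) (c : A) :
    leftAct σ lam t (leftAct σ lam s (c ⊗ₜ z)) =
      leftAct σ lam (shuffleMul σ lam t s) (c ⊗ₜ z) := by
  rw [leftAct_tmul, leftAct_tmul, braid_shuffleMul lam hσ, rightAct_leftAct h]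

theorem diamond_rightAct (hσ : IsBraidedAlgebra σ) (u : RSpace K A) (t : TensorSpace K A) (c : A) :
    diamond σ lam (rightAct σ lam t u) (c ⊗ₜ z) =
      diamond σ lam u (leftAct σ lam t (c ⊗ₜ z)) := by
  induction u using TensorProduct.induction_on with
  | zero => simp
  | add p q hp hq => simp only [map_add, LinearMap.add_apply, hp, hq]
  | tmul a x => rw [rightAct_tmul, diamond_tmul, diamond_tmul, leftAct_leftAct h hσ]

/-- For v = b ⊗ y, both sides equal β(t ⊗ b) ◇ (y ▷ (c ⊗ z)). -/
theorem diamond_leftAct (hσ : IsBraidedAlgebra σ) (t : TensorSpace K A) (v : RSpace K A) (c : A) :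
    diamond σ lam (leftAct σ lam t v) (c ⊗ₜ z) =
      leftAct σ lam t (diamond σ lam v (c ⊗ₜ z)) := by
  induction v using TensorProduct.induction_on with
  | zero => simp
  | add p q hp hq => simp only [map_add, LinearMap.add_apply, hp, hq]
  | tmul b y =>
    rw [diamond_tmul, leftAct_mulHead hσ, ← diamond_rightAct h hσ, leftAct_tmul]

theorem diamond_diamond_tmul (hσ : IsBraidedAlgebra σ) (u v : RSpace K A) (c : A) :
    diamond σ lam (diamond σ lam u v) (c ⊗ₜ z) =
      diamond σ lam u (diamond σ lam v (c ⊗ₜ z)) := by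
  induction u using TensorProduct.induction_on with
  | zero => simp
  | add p q hp hq => simp only [map_add, LinearMap.add_apply, hp, hq]
  | tmul a x =>
    rw [diamond_tmul, diamond_tmul, diamond_mulHead, diamond_leftAct h hσ]

end Relations

/-- The nesting, z outermost and x innermost, is what the relations require: `hz` allows any first
two factors, `hy` any first factor, and `hx` is used with the other two unchanged. -/
theorem shuffleMul_assoc (hσ : IsBraidedAlgebra σ) (x y z : TensorSpace K A) :
    shuffleMul σ lam (shuffleMul σ lam x y) z = shuffleMul σ lam x (shuffleMul σ lam y z) := by
  induction z using consMap_induction generalizing x y with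
  | one => rw [shuffleMul_one_right, shuffleMul_one_right]
  | add z z' hz hz' => simp only [map_add, hz, hz']
  | smul r z hz => simp only [map_smul, hz]
  | cons c z hz =>
    induction y using consMap_induction generalizing x with
    | one => rw [shuffleMul_one_right, shuffleMul_one_left]
    | add y y' hy hy' => simp only [map_add, LinearMap.add_apply, hy, hy']
    | smul r y hy => simp only [map_smul, LinearMap.smul_apply, hy]
    | cons b y hy =>
      induction x using consMap_induction with
      | one => rw [shuffleMul_one_left, shuffleMul_one_left]
      | add x x' hx hx' => simp only [map_add, LinearMap.add_apply, hx, hx']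
      | smul r x hx => simp only [map_smul, LinearMap.smul_apply, hx]
      | cons a x hx =>
        have hr : rightAct σ lam (consMap K A (c ⊗ₜ z))
              (rightAct σ lam (consMap K A (b ⊗ₜ y)) (a ⊗ₜ x)) =
            rightAct σ lam (shuffleMul σ lam (consMap K A (b ⊗ₜ y)) (consMap K A (c ⊗ₜ z)))
              (a ⊗ₜ x) := by
          rw [rightAct_tmul, rightAct_tmul, rightAct_tmul, hx]
        -- All four products are expanded, then the two inner ones are folded back where they occur
        -- as acting tensors.
        rw [shuffleMul_consMap σ lam (a ⊗ₜ x), shuffleMul_consMap,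
          shuffleMul_consMap σ lam (b ⊗ₜ y), shuffleMul_consMap, ← shuffleMul_consMap σ lam (a ⊗ₜ x),
          ← shuffleMul_consMap σ lam (b ⊗ₜ y)]
        refine congrArg _ ?_
        -- The seven relations: one from `hx` through `hr`, two from `hy`, four from `hz`.
        simp only [map_add, map_smul, LinearMap.add_apply, LinearMap.smul_apply, hr,
          rightAct_leftAct_tmul hy, rightAct_diamond_tmul hy, ← leftAct_leftAct hz hσ,
          diamond_rightAct hz hσ, diamond_leftAct hz hσ, diamond_diamond_tmul hz hσ, smul_add]
        abel

theorem isAlgebraProduct_diamond (hσ : IsBraidedAlgebra σ) :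
    IsAlgebraProduct (diamond σ lam) := by
  intro u v w
  induction w using TensorProduct.induction_on with
  | zero => simp
  | add p q hp hq => simp only [map_add, hp, hq]
  | tmul c z =>
    exact diamond_diamond_tmul (fun x y => shuffleMul_assoc lam hσ x y z) hσ u v c

end Associativity

/-! ### Projections along complementary subalgebras. -/

section Projection

variable {K R : Type*} [Field K] [AddCommGroup R] [Module K R]

/-- The projection onto a subalgebra along a complementary subalgebra is an idempotent Rota-Baxter
operator of weight `-1`. -/
theorem isIdempotentRotaBaxter_projection {mul : R →ₗ[K] R →ₗ[K] R} (hmul : IsAlgebraProduct mul)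
    {S S' : Submodule K R} (hS : IsSubalgebra mul S) (hS' : IsSubalgebra mul S')
    (h : IsCompl S S') : IsIdempotentRotaBaxter mul (-1) (S.projection S' h) := by
  have hid (s : R) (hs : s ∈ S) : S.projection S' h s = s :=
    Submodule.projection_apply_left h ⟨s, hs⟩
  have hker (s : R) (hs : s ∈ S') : S.projection S' h s = 0 :=
    (Submodule.projection_apply_eq_zero_iff h).2 hs
  have hdec (u : R) : ∃ s ∈ S, ∃ t ∈ S', s + t = u :=
    Submodule.mem_sup.1 (h.sup_eq_top ▸ Submodule.mem_top)
  refine ⟨⟨hmul, fun u v => ?_⟩, LinearMap.ext fun u => ?_⟩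
  · obtain ⟨s, hs, t, ht, rfl⟩ := hdec u
    obtain ⟨s', hs', t', ht', rfl⟩ := hdec v
    simp only [map_add, LinearMap.add_apply, hid s hs, hid s' hs', hker t ht, hker t' ht',
      hid _ (hS s hs s' hs'), hker _ (hS' t ht t' ht'), add_zero]
    -- The mixed terms P(s s'-part with t') and P(t with s') occur once with each sign and cancel;
    -- what remains is 2 s s' − s s' = s s'.
    module
  · obtain ⟨s, hs, t, ht, rfl⟩ := hdec u
    simp only [LinearMap.comp_apply, map_add, hid s hs, hker t ht, map_zero, add_zero]

end Projection

/-! ### Splitting A ⊗ T(A) into empty and nonempty tails. -/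

section Decomposition

variable {K A : Type*} [Field K] [NonUnitalRing A] [Module K A]

theorem inclusion_apply (a : A) : inclusion K A a = a ⊗ₜ tensorOne K A := rfl

theorem range_inclusion : LinearMap.range (inclusion K A) = scalarPart K A := by
  apply le_antisymm
  · rintro _ ⟨a, rfl⟩
    exact ⟨a ⊗ₜ (zeroEquiv K A).symm 1, LinearMap.lTensor_tmul _ _ _ _⟩
  · rintro _ ⟨p, rfl⟩
    induction p with
    | zero => simp
    | add p q hp hq => rw [map_add]; exact add_mem hp hq
    | tmul a x =>
      refine ⟨zeroEquiv K A x • a, ?_⟩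
      rw [LinearMap.lTensor_tmul, homogeneous_zero_apply, inclusion_apply,
        TensorProduct.smul_tmul]

/-- Describing nonempty tails by `consMap` makes the recursions for β and ⋈ applicable without
tracking degrees. -/
theorem positivePart_eq_range :
    positivePart K A = LinearMap.range (LinearMap.lTensor A (consMap K A)) := by
  apply le_antisymm
  · refine iSup₂_le fun i hi => ?_
    obtain ⟨n, rfl⟩ := Nat.exists_eq_add_of_le' hi
    have h : homogeneous K A (n + 1) = consMap K A ∘ₗ LinearMap.lTensor A (homogeneous K A n) ∘ₗ
        (consEquiv K A n).symm.toLinearMap := by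
      refine LinearMap.ext fun x => ?_
      obtain ⟨y, rfl⟩ := (consEquiv K A n).surjective x
      simp only [LinearMap.comp_apply, LinearEquiv.coe_coe, LinearEquiv.symm_apply_apply]
      induction y with
      | zero => simp
      | add p q hp hq => simp only [map_add, hp, hq]
      | tmul a y => rw [LinearMap.lTensor_tmul, consMap_tmul_homogeneous]
    rw [h, LinearMap.lTensor_comp]
    exact LinearMap.range_comp_le_range _ _
  · rintro _ ⟨p, rfl⟩
    induction p using TensorProduct.induction_on with
    | zero => simp
    | add p q hp hq => rw [map_add]; exact add_mem hp hq
    | tmul a p =>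
      induction p using TensorProduct.induction_on with
      | zero => simp
      | add p q hp hq => rw [TensorProduct.tmul_add, map_add]; exact add_mem hp hq
      | tmul b x =>
        induction x using tensorSpace_induction_homogeneous with
        | zero => simp
        | add x y hx hy =>
          rw [TensorProduct.tmul_add, TensorProduct.tmul_add, map_add]; exact add_mem hx hy
        | h n x =>
          rw [LinearMap.lTensor_tmul, consMap_tmul_homogeneous]
          exact Submodule.mem_iSup_of_mem (n + 1) (Submodule.mem_iSup_of_mem (by omega)
            ⟨a ⊗ₜ consEquiv K A n (b ⊗ₜ x), LinearMap.lTensor_tmul _ _ _ _⟩)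

theorem component_zero_consMap (p : RSpace K A) :
    DirectSum.component K ℕ (fun n => ⨂[K]^n A) 0 (consMap K A p) = 0 := by
  induction p using TensorProduct.induction_on with
  | zero => simp
  | add p q hp hq => simp only [map_add, hp, hq, add_zero]
  | tmul b x =>
    induction x using tensorSpace_induction_homogeneous with
    | zero => simp
    | add x y hx hy => simp only [TensorProduct.tmul_add, map_add, hx, hy, add_zero]
    | h n x =>
      rw [consMap_tmul_homogeneous, DirectSum.component.of, dif_neg (by omega)]

theorem isCompl_scalarPart_positivePart : IsCompl (scalarPart K A) (positivePart K A) := by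
  rw [positivePart_eq_range]
  constructor
  · rw [Submodule.disjoint_def]
    rintro _ ⟨p, rfl⟩ ⟨q, hq⟩
    -- The degree-zero component of the tail recovers p, and it annihilates everything of the form
    -- `consMap`.
    have h0 : LinearMap.lTensor A (DirectSum.component K ℕ (fun n => ⨂[K]^n A) 0)
        (LinearMap.lTensor A (homogeneous K A 0) p) = p := by
      rw [← LinearMap.comp_apply, ← LinearMap.lTensor_comp]
      convert LinearMap.id_apply (R := K) p
      rw [← LinearMap.lTensor_id]
      congr 1
    have h1 : LinearMap.lTensor A (DirectSum.component K ℕ (fun n => ⨂[K]^n A) 0)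
        (LinearMap.lTensor A (consMap K A) q) = 0 := by
      rw [← LinearMap.comp_apply, ← LinearMap.lTensor_comp,
        show DirectSum.component K ℕ (fun n => ⨂[K]^n A) 0 ∘ₗ consMap K A = 0 from
          LinearMap.ext component_zero_consMap]
      simp
    rw [← h0, ← hq, h1, map_zero]
  · rw [codisjoint_iff, eq_top_iff]
    rintro u -
    induction u using TensorProduct.induction_on with
    | zero => exact zero_mem _
    | add u v hu hv => exact add_mem hu hv
    | tmul a x =>
      induction x using consMap_induction with
      | one => exact Submodule.mem_sup_left ⟨a ⊗ₜ (zeroEquiv K A).symm 1,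
          LinearMap.lTensor_tmul _ _ _ _⟩
      | add x y hx hy => rw [TensorProduct.tmul_add]; exact add_mem hx hy
      | smul r x hx => rw [TensorProduct.tmul_smul]; exact Submodule.smul_mem _ _ hx
      | cons b x _ => exact Submodule.mem_sup_right ⟨a ⊗ₜ (b ⊗ₜ x), LinearMap.lTensor_tmul _ _ _ _⟩

theorem inclusion_injective : Function.Injective (inclusion K A) := by
  -- The degree-zero coefficient; id ⊗ f is a left inverse of the inclusion.
  let f : TensorSpace K A →ₗ[K] K :=
    (zeroEquiv K A).toLinearMap ∘ₗ DirectSum.component K ℕ (fun n => ⨂[K]^n A) 0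
  have hf : f (tensorOne K A) = 1 := by
    simp [f, tensorOne, DirectSum.component.lof_self]
  refine Function.LeftInverse.injective
    (g := (TensorProduct.rid K A).toLinearMap ∘ₗ LinearMap.lTensor A f) fun a => ?_
  simp [inclusion_apply, hf]

variable [IsScalarTower K A A] [SMulCommClass K A A] (σ : A ⊗[K] A →ₗ[K] A ⊗[K] A) (lam : K)

theorem inclusion_mul (a b : A) :
    inclusion K A (a * b) = diamond σ lam (inclusion K A a) (inclusion K A b) := by
  simp only [inclusion_apply, diamond_tmul, leftAct_tmul, braid_one, rightAct_tmul,
    shuffleMul_one_left, mulHead_tmul]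

theorem isSubalgebra_scalarPart : IsSubalgebra (diamond σ lam) (scalarPart K A) := by
  rw [← range_inclusion]
  rintro _ ⟨a, rfl⟩ _ ⟨b, rfl⟩
  exact ⟨a * b, inclusion_mul σ lam a b⟩

/-- A nonempty tail stays nonempty when a letter crosses it (`braid_consMap`), and the ⋈-product of
two nonempty tails lies in the image of `consMap` (`shuffleMul_consMap`). -/
theorem isSubalgebra_positivePart : IsSubalgebra (diamond σ lam) (positivePart K A) := by
  rw [positivePart_eq_range]
  rintro _ ⟨p, rfl⟩ _ ⟨q, rfl⟩
  induction q using TensorProduct.induction_on with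
  | zero => simp
  | add q q' hq hq' => rw [map_add, map_add]; exact add_mem hq hq'
  | tmul b v =>
    induction p using TensorProduct.induction_on with
    | zero => simp
    | add p p' hp hp' => rw [map_add, map_add, LinearMap.add_apply]; exact add_mem hp hp'
    | tmul a u =>
      have key (r : A ⊗[K] RSpace K A) :
          mulHead a (rightAct σ lam (consMap K A v) (LinearMap.lTensor A (consMap K A) r)) ∈
            LinearMap.range (LinearMap.lTensor A (consMap K A)) := by
        induction r using TensorProduct.induction_on with
        | zero => simp
        | add p p' hp hp' => simp only [map_add]; exact add_mem hp hp'
        | tmul c w =>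
          rw [LinearMap.lTensor_tmul, rightAct_tmul, shuffleMul_consMap, mulHead_tmul]
          exact ⟨_, LinearMap.lTensor_tmul _ _ _ _⟩
      rw [LinearMap.lTensor_tmul, LinearMap.lTensor_tmul, diamond_tmul, leftAct_tmul]
      induction u using TensorProduct.induction_on with
      | zero => simp
      | add p p' hp hp' => simp only [map_add, LinearMap.add_apply]; exact add_mem hp hp'
      | tmul c x => rw [braid_consMap, consBraid_eq]; exact key _

end Decomposition

end

end BraidedRotaBaxter

theorem theorem2p6 {K A : Type*} [Field K] [CharZero K] [NonUnitalRing A] [Module K A]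
    [IsScalarTower K A A] [SMulCommClass K A A] (σ : A ⊗[K] A →ₗ[K] A ⊗[K] A)
    (hσ : BraidedRotaBaxter.IsBraidedAlgebra σ) (lam : K) :
    -- `R_{σ,λ}(A)` is an associative algebra
    BraidedRotaBaxter.IsAlgebraProduct (BraidedRotaBaxter.diamond σ lam) ∧
    -- `A ⊗ K` and `⨁_{i ≥ 1} A ⊗ A^{⊗ i}` are subalgebras
    BraidedRotaBaxter.IsSubalgebra (BraidedRotaBaxter.diamond σ lam)
      (BraidedRotaBaxter.scalarPart K A) ∧
    BraidedRotaBaxter.IsSubalgebra (BraidedRotaBaxter.diamond σ lam)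
      (BraidedRotaBaxter.positivePart K A) ∧
    -- `a ↦ a ⊗ 1` is an isomorphism of algebras from `A` onto `A ⊗ K`
    (Function.Injective (BraidedRotaBaxter.inclusion K A) ∧
      LinearMap.range (BraidedRotaBaxter.inclusion K A) = BraidedRotaBaxter.scalarPart K A ∧
      ∀ a b : A, BraidedRotaBaxter.inclusion K A (a * b) =
        BraidedRotaBaxter.diamond σ lam (BraidedRotaBaxter.inclusion K A a)
          (BraidedRotaBaxter.inclusion K A b)) ∧
    -- the two subalgebras are complementary, and both projections are idempotent Rota-Baxter
    -- operators of weight `-1`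
    ∃ h : IsCompl (BraidedRotaBaxter.scalarPart K A) (BraidedRotaBaxter.positivePart K A),
      BraidedRotaBaxter.IsIdempotentRotaBaxter (BraidedRotaBaxter.diamond σ lam) (-1)
        ((BraidedRotaBaxter.scalarPart K A).projection (BraidedRotaBaxter.positivePart K A) h) ∧
      BraidedRotaBaxter.IsIdempotentRotaBaxter (BraidedRotaBaxter.diamond σ lam) (-1)
        ((BraidedRotaBaxter.positivePart K A).projection
          (BraidedRotaBaxter.scalarPart K A) h.symm) := by
  have h₀ := BraidedRotaBaxter.isSubalgebra_scalarPart σ lam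
  have h₁ := BraidedRotaBaxter.isSubalgebra_positivePart σ lam
  have hmul := BraidedRotaBaxter.isAlgebraProduct_diamond lam hσ
  have hc := BraidedRotaBaxter.isCompl_scalarPart_positivePart (K := K) (A := A)
  exact ⟨hmul, h₀, h₁, ⟨BraidedRotaBaxter.inclusion_injective, BraidedRotaBaxter.range_inclusion,
    BraidedRotaBaxter.inclusion_mul σ lam⟩, hc,
    BraidedRotaBaxter.isIdempotentRotaBaxter_projection hmul h₀ h₁ hc,
    BraidedRotaBaxter.isIdempotentRotaBaxter_projection hmul h₁ h₀ hc.symm⟩
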